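/- Theorem (NL certificate polytopes). Let $L\subseteq\{0,1\}^*$ be a language in $\mathrm{NL}$, and let $M$ be a deterministic logspace verifier for $L$ with certificates of polynomial length $q(\cdot)$. That is, $M$ is a deterministic Turing machine with a two-way read-only input tape, a read-only certificate tape whose head never moves to the left, and a read/write work tape; $q:\mathbb N\to\mathbb N$ is a polynomial function; on every input $x$ and every certificate $u\in\{0,1\}^{q(|x|)}$ the machine uses $\mathcal O(\log|x|)$ cells of its work tape; and $$x\in L\iff \exists\,u\in\{0,1\}^{q(|x|)}:\ M(x,u)=1,$$ where $M(x,u)=1$ means that $M$, started with $x$ on the input tape and $u$ on the certificate tape, halts in an accepting state. Then there is a polynomial $p$ (depending on $M$ and $q$ only) such that for every $n$ and every instance $x\in\{0,1\}^n$, whether or not $x\in L$, the polytope $$P_{(L,M)}(x)=\operatorname{conv}\{\,y\in\{0,1\}^{q(n)} \mid M(x,y)=1\,\}\subseteq\mathbb R^{q(n)}$$ has extension complexity at most $p(n)$. Here the extension complexity of a polytope $P$ is the least number $r$ such that $P$ is the image under an affine map of a polytope that can be described by $r$ linear inequalities. -/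

import Mathlib

/-! ### Deterministic verifiers with a one-way certificate tape -/

/-- What the head of the read-only input tape sees: `⊢ x₀ x₁ … xₙ₋₁ ⊣`. -/
inductive InputSymbol where
  | leftEnd
  | bit (b : Bool)
  | rightEnd

/-- Symbol in cell `i` of the input tape `⊢ x ⊣`: cell `0` holds `⊢`, cells `1, …, |x|` hold the
bits of `x`, and cell `|x| + 1` holds `⊣`. -/
def inputSymbol (x : List Bool) : ℕ → InputSymbol
  | 0 => .leftEnd
  | i + 1 =>
    match x[i]? with
    | some b => .bit b
    | none => .rightEnd

/-- Head moves on a two-way tape. -/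
inductive HeadMove where
  | left
  | stay
  | right

/-- The new head position; a left move in cell `0` leaves the head where it is. -/
def HeadMove.apply : HeadMove → ℕ → ℕ
  | .left, i => i - 1
  | .stay, i => i
  | .right, i => i + 1

/-- What a machine does in one step. On the certificate tape it can only advance by one cell to the
right (`advance = true`) or stay put (`advance = false`). -/
structure VerifierAction (Q Γ : Type) where
  state : Q
  inputMove : HeadMove
  advance : Bool
  write : Γ
  workMove : HeadMove

/-- A deterministic Turing machine with three tapes: a two-way read-only input tape (with end
markers), a one-way read-only certificate tape, and a read/write work tape that is infinite to the
right. The transition depends on the state, the input symbol, the certificate symbol (`none` past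
the end of the certificate) and the work symbol; the value `none` means that the machine halts. -/
structure CertVerifier where
  /-- states -/
  Q : Type
  /-- work-tape alphabet -/
  Γ : Type
  finite_Q : Finite Q
  finite_Γ : Finite Γ
  start : Q
  accept : Set Q
  blank : Γ
  transition : Q → InputSymbol → Option Bool → Γ → Option (VerifierAction Q Γ)

namespace CertVerifier

/-- A configuration. The field `cert` is the part of the certificate that starts at the head of the
certificate tape; what lies to its left can never be read again. -/
structure Config (M : CertVerifier) where
  state : M.Q
  inputHead : ℕ
  cert : List Bool
  work : ℕ → M.Γ
  workHead : ℕ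

/-- The initial configuration with certificate `u`: all heads on the leftmost cell of their tapes,
blank work tape. -/
def init (M : CertVerifier) (u : List Bool) : M.Config where
  state := M.start
  inputHead := 0
  cert := u
  work := fun _ => M.blank
  workHead := 0

/-- One step on input `x` (`none` if the machine halts). The input head cannot leave the cells
`0, …, |x| + 1` of the tape `⊢ x ⊣`. -/
def step (M : CertVerifier) (x : List Bool) (c : M.Config) : Option M.Config :=
  (M.transition c.state (inputSymbol x c.inputHead) c.cert.head? (c.work c.workHead)).map
    fun a =>
      { state := a.state
        inputHead := min (a.inputMove.apply c.inputHead) (x.length + 1)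
        cert := if a.advance then c.cert.tail else c.cert
        work := Function.update c.work c.workHead a.write
        workHead := a.workMove.apply c.workHead }

/-- `M` reaches the configuration `c` in its computation on input `x` and certificate `u`. -/
def Reaches (M : CertVerifier) (x u : List Bool) (c : M.Config) : Prop :=
  StateTransition.Reaches (M.step x) (M.init u) c

/-- `M(x, u) = 1`: on input `x` and certificate `u` the machine halts in an accepting state. -/
def Accepts (M : CertVerifier) (x u : List Bool) : Prop :=
  ∃ c, M.Reaches x u c ∧ M.step x c = none ∧ c.state ∈ M.accept

/-- `M` runs in space `s` on certificates of length `q(|x|)`: for every input `x` its work head only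
ever visits the first `s(|x|)` cells of the work tape. -/
def RunsInSpace (M : CertVerifier) (q s : ℕ → ℕ) : Prop :=
  ∀ (x : List Bool) (u : Fin (q x.length) → Bool) (c : M.Config),
    M.Reaches x (List.ofFn u) c → c.workHead < s x.length

/-- `M` is a logspace verifier for `L` with certificates of length `q(|x|)`, `q` a polynomial
function. -/
structure IsLogspaceVerifier (M : CertVerifier) (q : ℕ → ℕ) (L : Language Bool) : Prop where
  polynomial_length : ∃ p : Polynomial ℝ, ∀ n : ℕ, (q n : ℝ) = p.eval (n : ℝ)
  logspace : ∃ s : ℕ → ℕ, M.RunsInSpace q s ∧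
    (fun n : ℕ => (s n : ℝ)) =O[Filter.atTop] (fun n : ℕ => Real.log n)
  verifies : ∀ x : List Bool, x ∈ L ↔ ∃ u : Fin (q x.length) → Bool, M.Accepts x (List.ofFn u)

end CertVerifier

/-- The class NL, by its certificate definition. -/
def NL : Set (Language Bool) :=
  {L | ∃ (M : CertVerifier) (q : ℕ → ℕ), M.IsLogspaceVerifier q L}

/-! ### Extension complexity -/

/-- The solution set of the `r` linear inequalities `A z ≤ b`. -/
def polyhedron {r m : ℕ} (A : Matrix (Fin r) (Fin m) ℝ) (b : Fin r → ℝ) : Set (Fin m → ℝ) :=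
  {z | ∀ i, A.mulVec z i ≤ b i}

/-- `P` is the image under an affine map (a projection) of a polytope, i.e. a bounded polyhedron,
that is described by `r` inequalities. -/
def HasExtendedFormulation {d : ℕ} (P : Set (Fin d → ℝ)) (r : ℕ) : Prop :=
  ∃ (m : ℕ) (A : Matrix (Fin r) (Fin m) ℝ) (b : Fin r → ℝ)
    (π : (Fin m → ℝ) →ᵃ[ℝ] (Fin d → ℝ)),
    Bornology.IsBounded (polyhedron A b) ∧ π '' polyhedron A b = P

/-- The extension complexity: the least size of an extended formulation of `P` (`⊤` if there is
none). -/
noncomputable def extensionComplexity {d : ℕ} (P : Set (Fin d → ℝ)) : ℕ∞ :=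
  ⨅ (r : ℕ) (_ : HasExtendedFormulation P r), (r : ℕ∞)

/-! ### The polytope of certificates -/

/-- A 0/1 string as a vector. -/
def bitVector {d : ℕ} (y : Fin d → Bool) : Fin d → ℝ :=
  fun i => if y i then 1 else 0

/-- The convex hull of the certificates `y ∈ {0,1}^{q(|x|)}` that `M` accepts for the instance
`x`. -/
def certificatePolytope (M : CertVerifier) (q : ℕ → ℕ) (x : List Bool) :
    Set (Fin (q x.length) → ℝ) :=
  convexHull ℝ (bitVector '' {y | M.Accepts x (List.ofFn y)})

/-! ### Extended formulations from finitely indexed linear constraints -/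

/-! Fix `x`. Since the certificate is read from left to right, once a prefix `w` is used up the
machine remembers of it only a snapshot: state, input head, work tape and work head. Logarithmic
space leaves polynomially many snapshots. If `w` is never used up, by halting or looping earlier,
the outcome does not depend on the continuation. So the language of accepted certificates has
polynomially many left quotients (`leftQuotient_mem_range`), and its Myhill–Nerode automaton is
small; membership of `x` in `L` plays no role.

The words of length `n` accepted by an automaton are the source-to-sink paths in its transition
graph unrolled into `n + 1` layers. Unit flows through this graph form a polytope of size linear in
`n` times the number of states. Since flows decompose into paths (`DFA.exists_flow_decomposition`),
it projects onto the hull of the accepted words (`DFA.flowProj_image`). -/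

theorem hasExtendedFormulation_of_constraints {d : ℕ} {ι κ : Type} [Fintype ι] [Fintype κ]
    (f : ι → (κ → ℝ) →ₗ[ℝ] ℝ) (b : ι → ℝ) (π : (κ → ℝ) →ₗ[ℝ] (Fin d → ℝ))
    (hb : Bornology.IsBounded {z | ∀ i, f i z ≤ b i}) :
    HasExtendedFormulation (π '' {z | ∀ i, f i z ≤ b i}) (Fintype.card ι) := by
  classical
  let E : (Fin (Fintype.card κ) → ℝ) ≃ₗ[ℝ] (κ → ℝ) :=
    LinearEquiv.funCongrLeft ℝ ℝ (Fintype.equivFin κ)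
  let e := Fintype.equivFin ι
  let A : Matrix (Fin (Fintype.card ι)) (Fin (Fintype.card κ)) ℝ :=
    LinearMap.toMatrix' (LinearMap.pi fun i => f (e.symm i) ∘ₗ E.toLinearMap)
  have hpoly : polyhedron A (fun i => b (e.symm i)) = E.symm '' {z | ∀ i, f i z ≤ b i} := by
    ext z
    have hA : ∀ i, A.mulVec z i = f (e.symm i) (E z) := fun i => by
      have := LinearMap.toMatrix'_mulVec
        (LinearMap.pi fun i => f (e.symm i) ∘ₗ E.toLinearMap) z
      exact congrFun this i
    simp only [polyhedron, Set.mem_ofPred_eq, hA, Set.mem_image]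
    constructor
    · intro h
      exact ⟨E z, fun i => by simpa using h (e i), by simp⟩
    · rintro ⟨w, hw, rfl⟩ i
      simpa using hw (e.symm i)
  refine ⟨_, A, fun i => b (e.symm i), (π ∘ₗ E.toLinearMap).toAffineMap, ?_, ?_⟩
  · rw [hpoly]
    exact E.symm.toContinuousLinearEquiv.lipschitz.isBounded_image hb
  · rw [hpoly, Set.image_image]
    simp

/-- A polytope in the unit cube that is cut out by finitely many linear equations. -/
theorem hasExtendedFormulation_of_equations {d : ℕ} {ι κ : Type} [Fintype ι] [Fintype κ]
    (g : (κ → ℝ) →ₗ[ℝ] (ι → ℝ)) (c : ι → ℝ) (π : (κ → ℝ) →ₗ[ℝ] (Fin d → ℝ)) :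
    HasExtendedFormulation (π '' {z | (∀ k, 0 ≤ z k ∧ z k ≤ 1) ∧ g z = c})
      (2 * (Fintype.card κ + Fintype.card ι)) := by
  let f : (κ ⊕ ι) ⊕ (κ ⊕ ι) → (κ → ℝ) →ₗ[ℝ] ℝ :=
    Sum.elim
      (Sum.elim (fun k => -LinearMap.proj k) fun i => -(LinearMap.proj i ∘ₗ g))
      (Sum.elim (fun k => LinearMap.proj k) fun i => LinearMap.proj i ∘ₗ g)
  let b : (κ ⊕ ι) ⊕ (κ ⊕ ι) → ℝ :=
    Sum.elim (Sum.elim (fun _ => 0) fun i => -c i) (Sum.elim (fun _ => 1) c)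
  have hset : {z | (∀ k, 0 ≤ z k ∧ z k ≤ 1) ∧ g z = c} = {z | ∀ i, f i z ≤ b i} := by
    ext z
    simp only [Set.mem_ofPred_eq, Sum.forall, f, b, Sum.elim_inl, Sum.elim_inr,
      LinearMap.neg_apply, LinearMap.proj_apply, LinearMap.comp_apply, neg_le_neg_iff,
      neg_nonpos, funext_iff]
    constructor
    · rintro ⟨h, h'⟩
      exact ⟨⟨fun k => (h k).1, fun i => (h' i).ge⟩, fun k => (h k).2, fun i => (h' i).le⟩
    · rintro ⟨⟨h₁, h₂⟩, h₃, h₄⟩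
      exact ⟨fun k => ⟨h₁ k, h₃ k⟩, fun i => le_antisymm (h₄ i) (h₂ i)⟩
  have hcard : 2 * (Fintype.card κ + Fintype.card ι) = Fintype.card ((κ ⊕ ι) ⊕ (κ ⊕ ι)) := by
    simp [two_mul]
  rw [hcard, hset]
  refine hasExtendedFormulation_of_constraints f b π ?_
  rw [← hset]
  refine (Metric.isBounded_Icc (0 : κ → ℝ) 1).subset ?_
  rintro z ⟨hz, -⟩
  exact ⟨fun k => (hz k).1, fun k => (hz k).2⟩

/-! ### Words of fixed length accepted by a finite automaton -/

theorem sum_fin_succ_bool {n : ℕ} (f : (Fin (n + 1) → Bool) → ℝ) :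
    ∑ v, f v = ∑ b, ∑ v : Fin n → Bool, f (Fin.cons b v) := by
  rw [← Fintype.sum_prod_type', ← Equiv.sum_comp (Fin.consEquiv fun _ => Bool)]
  rfl

/-- Every flow through the layered transition graph of a finite automaton is a nonnegative
combination of accepting runs. Here `m t s` is the mass in state `s` after `t` letters and
`z t s b` is the part of it that continues with the letter `b`. -/
theorem DFA.exists_flow_decomposition {σ : Type} [Fintype σ] [DecidableEq σ] (D : DFA Bool σ) :
    ∀ (n : ℕ) (m : Fin (n + 1) → σ → ℝ) (z : Fin n → σ → Bool → ℝ),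
      (∀ t s, 0 ≤ m t s) → (∀ t s b, 0 ≤ z t s b) →
      (∀ t s, m t.castSucc s = ∑ b, z t s b) →
      (∀ t s, m t.succ s = ∑ s', ∑ b, if D.step s' b = s then z t s' b else 0) →
      (∀ s, s ∉ D.accept → m (Fin.last n) s = 0) →
      ∃ w : σ → (Fin n → Bool) → ℝ, (∀ s v, 0 ≤ w s v) ∧ (∀ s, ∑ v, w s v = m 0 s) ∧
        (∀ s v, w s v ≠ 0 → D.evalFrom s (List.ofFn v) ∈ D.accept) ∧
        ∀ i, ∑ s, ∑ v, w s v * bitVector v i = ∑ s, z i s true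
  | 0, m, z, hm, _, _, _, hfin => by
    refine ⟨fun s _ => m 0 s, fun s _ => hm 0 s, fun s => by simp, fun s v h => ?_,
      fun i => i.elim0⟩
    by_contra hs
    exact h (hfin s (by simpa using hs))
  | n + 1, m, z, hm, hz, hout, hin, hfin => by
    obtain ⟨w, hw0, hw1, hwacc, hwmarg⟩ := D.exists_flow_decomposition n (fun t => m t.succ)
      (fun t => z t.succ) (fun t => hm _) (fun t => hz _) (fun t s => hout t.succ s)
      (fun t s => hin t.succ s) hfin
    have hle : ∀ s b, z 0 s b ≤ m 1 (D.step s b) := fun s b => by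
      have h0 : ∀ s' b', 0 ≤ if D.step s' b' = D.step s b then z 0 s' b' else 0 :=
        fun s' b' => by split_ifs <;> simp [hz]
      have h := hin 0 (D.step s b)
      simp only [Fin.succ_zero_eq_one] at h
      rw [h]
      calc z 0 s b = if D.step s b = D.step s b then z 0 s b else 0 := by simp
        _ ≤ ∑ b', if D.step s b' = D.step s b then z 0 s b' else 0 :=
          Finset.single_le_sum (f := fun b' => if D.step s b' = D.step s b then z 0 s b' else 0)
            (fun b' _ => h0 s b') (Finset.mem_univ b)
        _ ≤ _ := Finset.single_le_sum
            (f := fun s' => ∑ b', if D.step s' b' = D.step s b then z 0 s' b' else 0)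
            (fun s' _ => Finset.sum_nonneg fun b' _ => h0 s' b') (Finset.mem_univ s)
    -- A target of mass zero receives no flow, so the convention `x / 0 = 0` is harmless.
    have hcancel : ∀ s b, z 0 s b / m 1 (D.step s b) * m 1 (D.step s b) = z 0 s b := fun s b => by
      by_cases h : m 1 (D.step s b) = 0
      · have := hle s b
        rw [h] at this
        simp [h, le_antisymm this (hz 0 s b)]
      · exact div_mul_cancel₀ _ h
    have hw1' : ∀ s, ∑ v, w s v = m 1 s := hw1
    -- The flow on the first edge is split among the runs leaving its target in proportion to their
    -- weights.
    refine ⟨fun s v => z 0 s (v 0) / m 1 (D.step s (v 0)) * w (D.step s (v 0)) (Fin.tail v),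
      fun s v => mul_nonneg (div_nonneg (hz _ _ _) (hm _ _)) (hw0 _ _), fun s => ?_,
      fun s v h => ?_, fun i => ?_⟩
    · rw [sum_fin_succ_bool]
      simp only [Fin.cons_zero, Fin.tail_cons, ← Finset.mul_sum, hw1', hcancel]
      exact (hout 0 s).symm
    · rw [List.ofFn_succ]
      exact hwacc _ _ (right_ne_zero_of_mul h)
    · refine Fin.cases ?_ (fun i => ?_) i
      · refine Finset.sum_congr rfl fun s _ => ?_
        rw [sum_fin_succ_bool]
        simp [bitVector, ← Finset.mul_sum, hw1', hcancel]
      · rw [← hwmarg i]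
        have hL : ∀ s, ∑ v : Fin (n + 1) → Bool,
            z 0 s (v 0) / m 1 (D.step s (v 0)) * w (D.step s (v 0)) (Fin.tail v) *
              bitVector v i.succ =
            ∑ b, ∑ s', if D.step s b = s' then
              z 0 s b / m 1 s' * ∑ v, w s' v * bitVector v i else 0 := fun s => by
          rw [sum_fin_succ_bool]
          refine Finset.sum_congr rfl fun b _ => ?_
          simp [bitVector, Finset.mul_sum]
        simp only [hL]
        calc _ = ∑ s', ∑ s, ∑ b, (if D.step s b = s' then
              z 0 s b / m 1 s' * ∑ v, w s' v * bitVector v i else 0) :=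
              (Finset.sum_congr rfl fun s _ => Finset.sum_comm).trans Finset.sum_comm
          _ = _ := by
              refine Finset.sum_congr rfl fun s' _ => ?_
              have h1 : ∀ s b, (if D.step s b = s' then
                  z 0 s b / m 1 s' * ∑ v, w s' v * bitVector v i else 0) =
                  (if D.step s b = s' then z 0 s b else 0) *
                    ((∑ v, w s' v * bitVector v i) / m 1 s') := fun s b => by
                split_ifs <;> ring
              simp only [h1, ← Finset.sum_mul]
              have h2 := hin 0 s'
              simp only [Fin.succ_zero_eq_one] at h2
              rw [← h2]
              by_cases h : m 1 s' = 0
              · have h3 : ∀ v, w s' v = 0 := fun v =>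
                  (Finset.sum_eq_zero_iff_of_nonneg fun v _ => hw0 s' v).1
                    ((hw1' s').trans h) v (Finset.mem_univ v)
                simp [h3]
              · exact mul_div_cancel₀ _ h

namespace DFA

variable {σ : Type} [Fintype σ] [DecidableEq σ]

/-- Coordinates of the flow polytope: node masses and edge flows. -/
abbrev FlowVar (σ : Type) (n : ℕ) : Type := (Fin (n + 1) × σ) ⊕ (Fin n × σ × Bool)

/-- Equations of the flow polytope: initial and final layer, outgoing and incoming flow. -/
abbrev FlowEq (σ : Type) (n : ℕ) : Type := (σ ⊕ σ) ⊕ ((Fin n × σ) ⊕ (Fin n × σ))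

open Classical in
/-- Left-hand sides of the flow equations. -/
noncomputable def flowMap (D : DFA Bool σ) (n : ℕ) :
    (FlowVar σ n → ℝ) →ₗ[ℝ] (FlowEq σ n → ℝ) :=
  LinearMap.pi (Sum.elim
    (Sum.elim
      (fun s => LinearMap.proj (Sum.inl (0, s)))
      (fun s => if s ∈ D.accept then 0 else LinearMap.proj (Sum.inl (Fin.last n, s))))
    (Sum.elim
      (fun e => LinearMap.proj (Sum.inl (e.1.castSucc, e.2)) -
        ∑ b, LinearMap.proj (Sum.inr (e.1, e.2, b)))
      (fun e => LinearMap.proj (Sum.inl (e.1.succ, e.2)) -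
        ∑ s, ∑ b, if D.step s b = e.2 then LinearMap.proj (Sum.inr (e.1, s, b)) else 0)))

/-- Right-hand sides of the flow equations. -/
def flowRhs (D : DFA Bool σ) (n : ℕ) : FlowEq σ n → ℝ :=
  Sum.elim (Sum.elim (fun s => if s = D.start then 1 else 0) fun _ => 0) fun _ => 0

/-- The projection of a flow to the word it spells. -/
def flowProj (σ : Type) [Fintype σ] (n : ℕ) : (FlowVar σ n → ℝ) →ₗ[ℝ] (Fin n → ℝ) :=
  LinearMap.pi fun i => ∑ s, LinearMap.proj (Sum.inr (i, s, true))

theorem flowMap_eq_iff (D : DFA Bool σ) (n : ℕ) (z : FlowVar σ n → ℝ) :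
    D.flowMap n z = D.flowRhs n ↔
      (∀ s, z (.inl (0, s)) = if s = D.start then 1 else 0) ∧
      (∀ s, s ∉ D.accept → z (.inl (Fin.last n, s)) = 0) ∧
      (∀ t s, z (.inl (Fin.castSucc t, s)) = ∑ b, z (.inr (t, s, b))) ∧
      (∀ t s, z (.inl (Fin.succ t, s)) =
        ∑ s', ∑ b, if D.step s' b = s then z (.inr (t, s', b)) else 0) := by
  classical
  have h1 : ∀ s, (if s ∈ D.accept then (0 : (FlowVar σ n → ℝ) →ₗ[ℝ] ℝ)
      else LinearMap.proj (Sum.inl (Fin.last n, s))) z = 0 ↔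
      (s ∉ D.accept → z (.inl (Fin.last n, s)) = 0) := fun s => by
    split_ifs with h <;> simp [h]
  have h2 : ∀ (t : Fin n) (s s' : σ) (b : Bool),
      (if D.step s' b = s then (LinearMap.proj (Sum.inr (t, s', b)) :
        (FlowVar σ n → ℝ) →ₗ[ℝ] ℝ) else 0) z =
      if D.step s' b = s then z (.inr (t, s', b)) else 0 := fun t s s' b => by
    split_ifs <;> simp
  simp only [flowMap, flowRhs, funext_iff, LinearMap.pi_apply, Sum.forall, Sum.elim_inl,
    Sum.elim_inr, h1, LinearMap.proj_apply, LinearMap.sub_apply, LinearMap.sum_apply, h2,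
    sub_eq_zero, Prod.forall, and_assoc]

/-- The hull of the words of length `n` accepted by a finite automaton is a projection of its flow
polytope. -/
theorem flowProj_image (D : DFA Bool σ) (n : ℕ) :
    flowProj σ n '' {z | (∀ k, 0 ≤ z k ∧ z k ≤ 1) ∧ D.flowMap n z = D.flowRhs n} =
      convexHull ℝ (bitVector '' {y : Fin n → Bool | List.ofFn y ∈ D.accepts}) := by
  apply Set.Subset.antisymm
  · rintro _ ⟨z, ⟨hz, he⟩, rfl⟩
    obtain ⟨hini, hfin, hout, hin⟩ := (D.flowMap_eq_iff n z).1 he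
    obtain ⟨w, hw0, hw1, hwacc, hwmarg⟩ := D.exists_flow_decomposition n
      (fun t s => z (.inl (t, s))) (fun t s b => z (.inr (t, s, b)))
      (fun _ _ => (hz _).1) (fun _ _ _ => (hz _).1) hout hin hfin
    -- All initial mass sits at the start state, so only its runs carry weight, and their weights
    -- sum to 1.
    have hother : ∀ s v, s ≠ D.start → w s v = 0 := fun s v hs =>
      (Finset.sum_eq_zero_iff_of_nonneg fun v _ => hw0 s v).1
        ((hw1 s).trans (by simp [hini, hs])) v (Finset.mem_univ v)
    have hsum : flowProj σ n z = ∑ v with w D.start v ≠ 0, w D.start v • bitVector v := by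
      rw [Finset.sum_filter_of_ne fun v _ h => left_ne_zero_of_smul h]
      ext i
      have h := hwmarg i
      rw [Finset.sum_eq_single D.start (fun s _ hs => by simp [hother s _ hs]) (by simp)] at h
      simp [flowProj, Finset.sum_apply, ← h]
    rw [hsum]
    refine (convex_convexHull ℝ _).sum_mem (fun v _ => hw0 _ v) ?_ fun v hv => ?_
    · rw [Finset.sum_filter_ne_zero, hw1]
      simp [hini]
    · exact subset_convexHull ℝ _
        ⟨v, hwacc _ v (Finset.mem_filter.1 hv).2, rfl⟩
  · refine convexHull_min ?_ ?_
    · rintro _ ⟨y, hy, rfl⟩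
      let st : ℕ → σ := fun t => D.eval ((List.ofFn y).take t)
      have hst : ∀ t : Fin n, st (t + 1) = D.step (st t) (y t) := fun t => by
        simp only [st]
        rw [← D.eval_append_singleton, List.take_add_one]
        simp
      -- The unit flow along the run on `y`.
      refine ⟨Sum.elim (fun k => if st k.1 = k.2 then 1 else 0)
        (fun k => if st k.1 = k.2.1 ∧ y k.1 = k.2.2 then 1 else 0), ⟨?_, ?_⟩, ?_⟩
      · rintro (k | k) <;> simp only [Sum.elim_inl, Sum.elim_inr] <;> split_ifs <;> simp
      · refine (D.flowMap_eq_iff n _).2 ⟨fun s => ?_, fun s hs => ?_, fun t s => ?_, fun t s => ?_⟩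
        · simp [st, eq_comm (a := D.start)]
        · have : st n ∈ D.accept := by
            have h : (List.ofFn y).take n = List.ofFn y := List.take_of_length_le (by simp)
            simp only [st, h]
            exact hy
          simp only [Sum.elim_inl, Fin.val_last, ite_eq_right_iff, one_ne_zero, imp_false]
          rintro rfl
          exact hs this
        · by_cases h : st t = s <;> simp [h]
        · simp only [Sum.elim_inl, Sum.elim_inr, Fin.val_succ, hst]
          rw [Finset.sum_eq_single (st t), Finset.sum_eq_single (y t)]
          · simp
          · intro b _ hb
            simp [hb.symm]
          · simp
          · intro s' _ hs'
            simp [hs'.symm]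
          · simp
      · ext i
        cases h : y i <;> simp [flowProj, bitVector, h, -Finset.sum_boole]
    · refine Convex.linear_image ?_ _
      rintro a ⟨ha, ha'⟩ b ⟨hb, hb'⟩ s t hs ht hst
      refine ⟨fun k => ?_, ?_⟩
      · have h := convex_Icc (0 : ℝ) 1 (ha k) (hb k) hs ht hst
        exact h
      · rw [map_add, map_smul, map_smul, ha', hb', ← add_smul, hst, one_smul]

/-- The hull of the words of length `n` accepted by a finite automaton with `k` states has an
extended formulation of size `O(n k)`. -/
theorem hasExtendedFormulation (D : DFA Bool σ) (n : ℕ) :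
    HasExtendedFormulation
      (convexHull ℝ (bitVector '' {y : Fin n → Bool | List.ofFn y ∈ D.accepts}))
      ((10 * n + 6) * Fintype.card σ) := by
  have h := hasExtendedFormulation_of_equations (D.flowMap n) (D.flowRhs n) (flowProj σ n)
  rw [flowProj_image] at h
  -- With `k` states there are `(3n + 1)k` variables and `(2n + 2)k` equations; each costs two
  -- inequalities.
  convert h using 1
  simp
  ring

end DFA

/-! ### Residual languages of a verifier -/

namespace CertVerifier

/-- Append `v` to the unread part of the certificate. -/
def Config.append {M : CertVerifier} (c : M.Config) (v : List Bool) : M.Config :=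
  { c with cert := c.cert ++ v }

/-- The computation on input `x` that starts in the configuration `c` halts and accepts. -/
def AcceptsFrom (M : CertVerifier) (x : List Bool) (c : M.Config) : Prop :=
  ∃ d, StateTransition.Reaches (M.step x) c d ∧ M.step x d = none ∧ d.state ∈ M.accept

/-- Determinism: configurations on the same run share their halting configuration, if there is one.
-/
theorem acceptsFrom_iff_of_reaches {M : CertVerifier} {x : List Bool} {c d : M.Config}
    (h : StateTransition.Reaches (M.step x) c d) : M.AcceptsFrom x c ↔ M.AcceptsFrom x d := by
  have key : ∀ c, M.AcceptsFrom x c ↔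
      ∃ e ∈ StateTransition.eval (M.step x) c, e.state ∈ M.accept := fun c => by
    simp only [AcceptsFrom, StateTransition.mem_eval, and_assoc]
  rw [key, key, StateTransition.reaches_eval h]

theorem step_append {M : CertVerifier} (x : List Bool) (c : M.Config) (v : List Bool)
    (hc : c.cert ≠ []) : M.step x (c.append v) = (M.step x c).map (·.append v) := by
  obtain ⟨b, w, h⟩ := List.exists_cons_of_ne_nil hc
  simp only [step, Config.append, h, List.cons_append, List.head?_cons, List.tail_cons,
    Option.map_map]
  congr 1
  funext a
  cases ha : a.advance <;> simp [ha]

/-- A verifier either reads all of a given piece of certificate, in a way that does not depend on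
what follows, or its answer does not depend on what follows. -/
theorem exhausts_or_decides (M : CertVerifier) (x : List Bool) (c : M.Config) :
    (∃ d : M.Config, d.cert = [] ∧
      ∀ v, StateTransition.Reaches (M.step x) (c.append v) (d.append v)) ∨
    ∀ v v', M.AcceptsFrom x (c.append v) → M.AcceptsFrom x (c.append v') := by
  refine or_iff_not_imp_left.2 fun h => ?_
  have hne : ∀ e : M.Config,
      (∀ v, StateTransition.Reaches (M.step x) (c.append v) (e.append v)) → e.cert ≠ [] :=
    fun e he hnil => h ⟨e, hnil, he⟩
  -- If the given piece is never used up, the runs for all continuations proceed in lockstep.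
  have hreach : ∀ v d, StateTransition.Reaches (M.step x) (c.append v) d →
      ∃ e : M.Config, d = e.append v ∧
        ∀ v', StateTransition.Reaches (M.step x) (c.append v') (e.append v') := fun v d hd => by
    induction hd with
    | refl => exact ⟨c, rfl, fun v' => .refl⟩
    | tail _ hstep ih =>
      obtain ⟨e, rfl, he⟩ := ih
      rw [step_append x e v (hne e he), Option.mem_map] at hstep
      obtain ⟨e', he', rfl⟩ := hstep
      refine ⟨e', rfl, fun v' => (he v').tail ?_⟩
      rw [step_append x e v' (hne e he)]
      exact Option.mem_map_of_mem _ he'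
  rintro v v' ⟨d, hd, hhalt, hacc⟩
  obtain ⟨e, rfl, he⟩ := hreach v d hd
  refine ⟨e.append v', he v', ?_, hacc⟩
  rw [step_append x e _ (hne e he), Option.map_eq_none_iff] at hhalt ⊢
  exact hhalt

/-- Configurations with `s` work cells on inputs of length `n`, without the certificate. -/
abbrev Snapshot (M : CertVerifier) (n s : ℕ) : Type :=
  M.Q × Fin (n + 2) × Fin s × (Fin s → M.Γ)

/-- The configuration described by a snapshot, with no certificate left. -/
def Snapshot.toConfig {M : CertVerifier} {n s : ℕ} (k : M.Snapshot n s) : M.Config where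
  state := k.1
  inputHead := k.2.1
  cert := []
  work := fun i => if h : i < s then k.2.2.2 ⟨i, h⟩ else M.blank
  workHead := k.2.2.1

/-- The certificates of length `k` accepted for the input `x`. -/
def certLanguage (M : CertVerifier) (x : List Bool) (k : ℕ) : Language Bool :=
  {u | u.length = k ∧ M.Accepts x u}

theorem exists_ofFn_eq {α : Type*} {k : ℕ} (l : List α) (hl : l.length = k) :
    ∃ f : Fin k → α, List.ofFn f = l := by
  subst hl
  exact ⟨l.get, List.ofFn_get l⟩

/-- Only visited cells are written, so all cells beyond the space bound stay blank. -/
theorem RunsInSpace.exists_snapshot {M : CertVerifier} {q s : ℕ → ℕ} (hs : M.RunsInSpace q s)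
    {x u : List Bool} (hu : u.length = q x.length) {c : M.Config} (hc : M.Reaches x u c) :
    ∃ k : M.Snapshot x.length (s x.length), k.toConfig = { c with cert := [] } := by
  obtain ⟨u, rfl⟩ := exists_ofFn_eq u hu
  have hinv : c.inputHead < x.length + 2 ∧ ∀ i, s x.length ≤ i → c.work i = M.blank := by
    induction hc with
    | refl => exact ⟨Nat.succ_pos _, fun _ _ => rfl⟩
    | @tail d e hd hstep ih =>
      have hhead := hs x u d hd
      simp only [step, Option.mem_def, Option.map_eq_some_iff] at hstep
      obtain ⟨a, -, rfl⟩ := hstep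
      refine ⟨Nat.lt_succ_of_le (min_le_right _ _), fun i hi => ?_⟩
      have hne : i ≠ d.workHead := by omega
      simpa [hne] using ih.2 i hi
  refine ⟨(c.state, ⟨c.inputHead, hinv.1⟩, ⟨c.workHead, hs x u c hc⟩, fun i => c.work i), ?_⟩
  simp only [Snapshot.toConfig, Config.mk.injEq, true_and, and_true]
  funext i
  split_ifs with h
  · rfl
  · exact (hinv.2 i (not_lt.1 h)).symm

/-- The possible left quotients of the language of accepted certificates of length `k`. -/
def residual (M : CertVerifier) (x : List Bool) (s k : ℕ) :
    Option (Fin (k + 1) × Option (M.Snapshot x.length s)) → Language Bool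
  | none => {_v | False}
  | some (t, none) => {v | t + v.length = k}
  | some (t, some d) => {v | t + v.length = k ∧ M.AcceptsFrom x (d.toConfig.append v)}

theorem RunsInSpace.leftQuotient_mem_range {M : CertVerifier} {q s : ℕ → ℕ}
    (hs : M.RunsInSpace q s) (x w : List Bool) :
    (M.certLanguage x (q x.length)).leftQuotient w ∈
      Set.range (M.residual x (s x.length) (q x.length)) := by
  have hmem : ∀ v, v ∈ (M.certLanguage x (q x.length)).leftQuotient w ↔
      w.length + v.length = q x.length ∧ M.AcceptsFrom x ((M.init w).append v) := fun v => by
    rw [← List.length_append]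
    rfl
  by_cases hw : w.length < q x.length + 1
  · rcases M.exhausts_or_decides x (M.init w) with ⟨d, hd, hreach⟩ | hdec
    · obtain ⟨k, hk⟩ := hs.exists_snapshot (u := w ++ List.replicate (q x.length - w.length) true)
        (by rw [List.length_append, List.length_replicate]; omega) (hreach _)
      have hkd : k.toConfig = d := by
        rw [hk]
        cases d
        simp_all [Config.append]
      refine ⟨some (⟨w.length, hw⟩, some k), ?_⟩
      ext v
      rw [hmem, acceptsFrom_iff_of_reaches (hreach v), ← hkd]
      rfl
    · by_cases hex : ∃ v, M.AcceptsFrom x ((M.init w).append v)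
      · obtain ⟨v₀, hv₀⟩ := hex
        refine ⟨some (⟨w.length, hw⟩, none), ?_⟩
        ext v
        rw [hmem, and_iff_left (hdec v₀ v hv₀)]
        rfl
      · refine ⟨none, ?_⟩
        ext v
        rw [hmem]
        exact ⟨False.elim, fun h => hex ⟨v, h.2⟩⟩
  · refine ⟨none, ?_⟩
    ext v
    rw [hmem]
    exact ⟨False.elim, fun h => hw (by omega)⟩

/-- A bound for the extension complexity in terms of the number of snapshots. -/
theorem RunsInSpace.extensionComplexity_le {M : CertVerifier} {q s : ℕ → ℕ}
    (hs : M.RunsInSpace q s) (x : List Bool) :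
    extensionComplexity (certificatePolytope M q x) ≤
      (((10 * q x.length + 6) * ((q x.length + 1) * (Nat.card M.Q * ((x.length + 2) *
        (s x.length * Nat.card M.Γ ^ s x.length)) + 1) + 1) : ℕ) : ℕ∞) := by
  classical
  have := M.finite_Q
  have := M.finite_Γ
  let K := M.certLanguage x (q x.length)
  -- These left quotients are the states of `K.toDFA`.
  have hsub : Set.range K.leftQuotient ⊆
      Set.range (M.residual x (s x.length) (q x.length)) := by
    rintro _ ⟨w, rfl⟩
    exact hs.leftQuotient_mem_range x w
  have hfin := Set.finite_range (M.residual x (s x.length) (q x.length))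
  let _ : Fintype (Set.range K.leftQuotient) := (hfin.subset hsub).fintype
  have hcard : Fintype.card (Set.range K.leftQuotient) ≤
      (q x.length + 1) * (Nat.card M.Q * ((x.length + 2) *
        (s x.length * Nat.card M.Γ ^ s x.length)) + 1) + 1 := by
    rw [← Nat.card_eq_fintype_card]
    refine (Nat.card_mono hfin hsub).trans ((Finite.card_range_le _).trans_eq ?_)
    simp [Finite.card_option, Nat.card_prod, Nat.card_fun]
  have hP : certificatePolytope M q x = convexHull ℝ
      (bitVector '' {y : Fin (q x.length) → Bool | List.ofFn y ∈ K.toDFA.accepts}) := by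
    rw [Language.accepts_toDFA]
    have : {y : Fin (q x.length) → Bool | List.ofFn y ∈ K} =
        {y | M.Accepts x (List.ofFn y)} := by
      ext y
      exact and_iff_right (List.length_ofFn)
    rw [this]
    rfl
  have hform := K.toDFA.hasExtendedFormulation (q x.length)
  rw [← hP] at hform
  refine (iInf₂_le _ hform).trans ?_
  exact_mod_cast Nat.mul_le_mul_left _ hcard

end CertVerifier

/-! ### Polynomially bounded functions -/

/-- `f` is bounded by a polynomial with natural coefficients. -/
def PolynomiallyBounded (f : ℕ → ℕ) : Prop :=
  ∃ p : Polynomial ℕ, ∀ n, f n ≤ p.eval n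

namespace PolynomiallyBounded

variable {f g : ℕ → ℕ}

theorem const (a : ℕ) : PolynomiallyBounded fun _ => a := ⟨.C a, fun n => by simp⟩

theorem id : PolynomiallyBounded fun n => n := ⟨.X, fun n => by simp⟩

theorem add (hf : PolynomiallyBounded f) (hg : PolynomiallyBounded g) :
    PolynomiallyBounded fun n => f n + g n := by
  obtain ⟨p, hp⟩ := hf
  obtain ⟨r, hr⟩ := hg
  exact ⟨p + r, fun n => by simpa using Nat.add_le_add (hp n) (hr n)⟩

theorem mul (hf : PolynomiallyBounded f) (hg : PolynomiallyBounded g) :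
    PolynomiallyBounded fun n => f n * g n := by
  obtain ⟨p, hp⟩ := hf
  obtain ⟨r, hr⟩ := hg
  exact ⟨p * r, fun n => by simpa using Nat.mul_le_mul (hp n) (hr n)⟩

theorem mono (hg : PolynomiallyBounded g) (h : ∀ n, f n ≤ g n) : PolynomiallyBounded f := by
  obtain ⟨p, hp⟩ := hg
  exact ⟨p, fun n => (h n).trans (hp n)⟩

theorem of_eventually_le (hg : PolynomiallyBounded g) (h : ∀ᶠ n in Filter.atTop, f n ≤ g n) :
    PolynomiallyBounded f := by
  obtain ⟨N, hN⟩ := Filter.eventually_atTop.1 h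
  refine (hg.add (const (∑ i ∈ Finset.range N, f i))).mono fun n => ?_
  by_cases hn : N ≤ n
  · exact (hN n hn).trans (Nat.le_add_right _ _)
  · exact (Finset.single_le_sum (fun i _ => Nat.zero_le (f i))
      (Finset.mem_range.2 (not_le.1 hn))).trans (Nat.le_add_left _ _)

theorem of_real_polynomial (p : Polynomial ℝ) (h : ∀ n, (f n : ℝ) = p.eval (n : ℝ)) :
    PolynomiallyBounded f := by
  refine ⟨∑ i ∈ Finset.range (p.natDegree + 1), .C ⌈p.coeff i⌉₊ * .X ^ i, fun n => ?_⟩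
  rw [← Nat.cast_le (α := ℝ), h, Polynomial.eval_eq_sum_range, Polynomial.eval_finsetSum]
  push_cast
  refine Finset.sum_le_sum fun i _ => ?_
  simp only [Polynomial.eval_mul, Polynomial.eval_C, Polynomial.eval_pow, Polynomial.eval_X,
    Nat.cast_mul, Nat.cast_pow]
  exact mul_le_mul_of_nonneg_right (Nat.le_ceil _) (by positivity)

theorem pow_of_isBigO_log {s : ℕ → ℕ}
    (hs : (fun n : ℕ => (s n : ℝ)) =O[Filter.atTop] fun n : ℕ => Real.log n) (a : ℕ) :
    PolynomiallyBounded fun n => a ^ s n := by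
  obtain ⟨C, hC⟩ := hs.bound
  -- From `s n ≤ C log n` one gets `(a + 1) ^ s n ≤ n ^ (C log (a + 1))`; the shift to `a + 1` keeps
  -- the logarithm nonnegative even for `a = 0`.
  let d := ⌈C * Real.log (a + 1)⌉₊
  have hpow : PolynomiallyBounded fun n => n ^ d := ⟨.X ^ d, fun n => by simp⟩
  refine hpow.of_eventually_le ?_
  filter_upwards [hC, Filter.eventually_ge_atTop 1] with n hn h1
  have hn1 : (1 : ℝ) ≤ n := by exact_mod_cast h1
  have hlog : 0 ≤ Real.log n := Real.log_nonneg hn1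
  have hloga : 0 ≤ Real.log (a + 1 : ℝ) := Real.log_nonneg (by simp)
  rw [Real.norm_of_nonneg (by positivity), Real.norm_of_nonneg hlog] at hn
  rw [← Nat.cast_le (α := ℝ)]
  push_cast
  calc (a : ℝ) ^ s n ≤ (a + 1 : ℝ) ^ s n := by gcongr; simp
    _ = Real.exp (s n * Real.log (a + 1)) := by
      rw [Real.exp_nat_mul, Real.exp_log (by positivity)]
    _ ≤ Real.exp (d * Real.log n) := by
      refine Real.exp_le_exp.2 ?_
      calc (s n : ℝ) * Real.log (a + 1) ≤ C * Real.log n * Real.log (a + 1) := by gcongr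
        _ = C * Real.log (a + 1) * Real.log n := by ring
        _ ≤ d * Real.log n := by gcongr; exact Nat.le_ceil _
    _ = (n : ℝ) ^ d := by rw [Real.exp_nat_mul, Real.exp_log (by positivity)]

end PolynomiallyBounded

theorem mainTheorem4 (L : Language Bool) (_hL : L ∈ NL)
    (M : CertVerifier) (q : ℕ → ℕ) (hM : M.IsLogspaceVerifier q L) :
    ∃ p : Polynomial ℕ, ∀ x : List Bool,
      extensionComplexity (certificatePolytope M q x) ≤ ((p.eval x.length : ℕ) : ℕ∞) := by
  obtain ⟨r, hr⟩ := hM.polynomial_length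
  obtain ⟨s, hs, hlog⟩ := hM.logspace
  have hq := PolynomiallyBounded.of_real_polynomial r hr
  have hspace : PolynomiallyBounded s :=
    (PolynomiallyBounded.pow_of_isBigO_log hlog 2).mono fun n => Nat.lt_two_pow_self.le
  have hwork := PolynomiallyBounded.pow_of_isBigO_log hlog (Nat.card M.Γ)
  have hsnap := (PolynomiallyBounded.const (Nat.card M.Q)).mul
    ((PolynomiallyBounded.id.add (.const 2)).mul (hspace.mul hwork))
  obtain ⟨p, hp⟩ := (((PolynomiallyBounded.const 10).mul hq).add (.const 6)).mul
    (((hq.add (.const 1)).mul (hsnap.add (.const 1))).add (.const 1))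
  exact ⟨p, fun x => (hs.extensionComplexity_le x).trans (by exact_mod_cast hp x.length)⟩
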